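/- Let $\mathcal E$ be the Bargmann–Fock space of all $u\in L^2(\mathbb C)$ of the form $u(z)=e^{-|z|^2/2}f(z)$ with $f$ entire, and let $M(u)=\int_{\mathbb C}|u|^2\,dL$, where $L$ is Lebesgue measure. For $\mu\in\mathbb R$ and $u\in\mathcal E$ put $$\mathcal G_\mu(u)=8\pi\mathcal H(u)+\mu P(u),\qquad \mathcal H(u)=\frac14\int_{\mathbb C}|u|^4\,dL,\qquad P(u)=\int_{\mathbb C}(|z|^2-1)|u(z)|^2\,dL(z)\in(-\infty,+\infty]$$ (with $0\cdot\infty=0$), and let $\phi_0(z)=\pi^{-1/2}e^{-|z|^2/2}$, $\phi_1(z)=\pi^{-1/2}z\,e^{-|z|^2/2}$. (a) For every $\mu>\frac12$, $\phi_0$ is the unique global minimizer of $\mathcal G_\mu$ over $\{u\in\mathcal E: M(u)=1\}$ up to phase rotations: the global minimizers are exactly the functions $e^{i\gamma}\phi_0$, $\gamma\in\mathbb R$. Space rotations $u\mapsto u(e^{i\theta}\,\cdot)$ leave $\phi_0$ unchanged, so this is also uniqueness up to phase and space rotations. (b) The condition $\mu>\frac12$ is optimal. For every $\mu<\frac12$,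 $\phi_1$ belongs to $\mathcal E$, $M(\phi_1)=1$ and $\mathcal G_\mu(\phi_1)<\mathcal G_\mu(\phi_0)$, so $\phi_0$ is not a global minimizer. Moreover, for every $\mu\in\mathbb R$, $\phi_0$ is a strict local minimizer of $\mathcal G_\mu$ on $\{u\in\mathcal E: M(u)=1\}$ if and only if $\mu>\frac12$. Here a strict local minimizer $w$ is one for which there is $\varepsilon>0$ such that $\mathcal G_\mu(w)<\mathcal G_\mu(u)$ for all $u\in\mathcal E$ with $M(u)=1$ and $\|\sqrt{1+|z|^2}\,(u-w)\|_{L^2(\mathbb C)}<\varepsilon$ that are not of the form $e^{i\gamma}w(e^{i\theta}\,\cdot)$ with $\gamma,\theta\in\mathbb R$. -/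

import Mathlib

open scoped ENNReal

noncomputable section

namespace LLL

/-- The integral over `ℂ` (Lebesgue measure) of a real function as an extended real number: the
integral of the positive part minus the integral of the negative part. -/
def extIntegral (g : ℂ → ℝ) : EReal :=
  ((∫⁻ z, ENNReal.ofReal (g z) : ℝ≥0∞) : EReal) - ((∫⁻ z, ENNReal.ofReal (-g z) : ℝ≥0∞) : EReal)

/-- The Bargmann-Fock space: functions `u z = exp (-|z|² / 2) * f z`, `f` entire,
that are square integrable on `ℂ`. -/
def bargmannFock : Set (ℂ → ℂ) :=
  {u | (∃ f : ℂ → ℂ, Differentiable ℂ f ∧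
      ∀ z, u z = (Real.exp (-‖z‖ ^ 2 / 2) : ℂ) * f z) ∧
    MeasureTheory.MemLp u 2 MeasureTheory.volume}

/-- The mass `M(u) = ∫ |u|²`. -/
def mass (u : ℂ → ℂ) : ℝ := ∫ z, ‖u z‖ ^ 2

/-- The Hamiltonian `H(u) = (1/4) ∫ |u|⁴`. -/
def hamiltonian (u : ℂ → ℂ) : EReal :=
  ((1 / 4 : ℝ) : EReal) * extIntegral (fun z => ‖u z‖ ^ 4)

/-- The angular momentum `P(u) = ∫ (|z|² - 1) |u|²`. For `u` in the Bargmann-Fock space the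
negative part is integrable, and `P(u) = +∞` exactly when `z u` is not square integrable. -/
def angularMomentum (u : ℂ → ℂ) : EReal :=
  extIntegral (fun z => (‖z‖ ^ 2 - 1) * ‖u z‖ ^ 2)

/-- The energy `G_μ = 8 π H + μ P`. -/
def energy (μ : ℝ) (u : ℂ → ℂ) : EReal :=
  ((8 * Real.pi : ℝ) : EReal) * hamiltonian u + (μ : EReal) * angularMomentum u

/-- Phase rotation `u ↦ e^{iγ} u`. -/
def phaseRotation (γ : ℝ) (u : ℂ → ℂ) : ℂ → ℂ := fun z => Complex.exp (Complex.I * γ) * u z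

/-- Space rotation `u ↦ u (e^{iθ} ·)`. -/
def spaceRotation (θ : ℝ) (u : ℂ → ℂ) : ℂ → ℂ := fun z => u (Complex.exp (Complex.I * θ) * z)

/-- The Gaussian `φ₀`. -/
def phi0 : ℂ → ℂ := fun z => ((1 / Real.sqrt Real.pi * Real.exp (-‖z‖ ^ 2 / 2) : ℝ) : ℂ)

/-- The special Hermite function `φ₁`. -/
def phi1 : ℂ → ℂ := fun z => ((1 / Real.sqrt Real.pi * Real.exp (-‖z‖ ^ 2 / 2) : ℝ) : ℂ) * z

/-- `w` is a global minimizer of `G_μ` on the unit-mass functions of the Bargmann-Fock space. -/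
def IsGlobalMinimizer (μ : ℝ) (w : ℂ → ℂ) : Prop :=
  w ∈ bargmannFock ∧ mass w = 1 ∧
    ∀ u ∈ bargmannFock, mass u = 1 → energy μ w ≤ energy μ u

/-- The weighted norm `‖⟨z⟩ u‖_{L²}`, with `⟨z⟩ = √(1 + |z|²)`. -/
def weightedNorm (u : ℂ → ℂ) : ℝ≥0∞ :=
  MeasureTheory.eLpNorm (fun z => (Real.sqrt (1 + ‖z‖ ^ 2) : ℂ) * u z) 2 MeasureTheory.volume

/-- `w` is a strict local minimizer (up to phase and space rotations) of `G_μ` on the unit-mass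
functions of the Bargmann-Fock space, neighbourhoods being those of the weighted norm. -/
def IsStrictLocalMinimizer (μ : ℝ) (w : ℂ → ℂ) : Prop :=
  w ∈ bargmannFock ∧ mass w = 1 ∧
    ∃ ε : ℝ≥0∞, 0 < ε ∧ ∀ u ∈ bargmannFock, mass u = 1 →
      weightedNorm (fun z => u z - w z) < ε →
      (∀ γ θ : ℝ, u ≠ phaseRotation γ (spaceRotation θ w)) →
      energy μ w < energy μ u

end LLL

end

namespace LLL

open MeasureTheory

/-! Everything rests on the inequality `mass_sq_le`. Write ρ = |u|², M = ∫ρ, K = ∫|z|²ρ; then 3M² ≤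
KM + 4π∫ρ². For M = 1 it reads 8πH ≥ 1 - P/2, hence G_μ ≥ 1 + (μ - 1/2)P. Since P ≥ 0, with equality
only for constant f (`integral_density_le_and_eq`), a unit-mass u with μ > 1/2 has G_μ(u) ≥ 1 =
G_μ(φ₀), with equality only at the phases of φ₀. To prove the inequality, view ρ(z)ρ(w) as a
two-particle density and put z = s + t, w = s - t. The parallelogram law splits the Gaussian, so for
fixed s what remains is |g(t)|² exp(-2|t|²) with g(t) = f(s+t)f(s-t) entire and even. Distinct
powers tⁿ are orthogonal on circles, and 2|t|² has mean n + 1 on tⁿ. Evenness excludes n = 1, so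
2|t|² has mean at least 3 except on n = 0, where the deficit 3 - 1 is paid for by |g(0)|², that is,
by ρ(s)². Integration over s gives ∫∫ |z-w|²ρρ/2 = KM - |∫zρ|² ≤ KM on one side and ∫ρ² on the
other. Optimality comes from aφ₀ + bφ₁, a² + b² = 1, translated so that its centre of mass is 0. Its
energy is exactly 1 + (μ - 1/2)b⁴ (`translatedPair_integrals`): b = 1 is φ₁, and b → 0 gives
competitors arbitrarily close to φ₀ that do no worse when μ ≤ 1/2. -/

/-! ### Radial Gaussian moments. -/

theorem integral_norm_pow_mul_gaussian (k : ℕ) {c : ℝ} (hc : 0 < c) :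
    ∫ z : ℂ, ‖z‖ ^ (2 * k) * Real.exp (-c * ‖z‖ ^ 2) =
      Real.pi * k.factorial / c ^ (k + 1) := by
  have h := Complex.integral_rpow_mul_exp_neg_mul_rpow (p := 2) (q := (2 * k : ℕ)) one_le_two
    (by have : (0 : ℝ) ≤ (2 * k : ℕ) := by positivity
        linarith) hc
  have e1 : (((2 * k : ℕ) : ℝ) + 2) / 2 = (k : ℝ) + 1 := by push_cast; ring
  have e2 : -(((2 * k : ℕ) : ℝ) + 2) / 2 = -((k + 1 : ℕ) : ℝ) := by push_cast; ring
  rw [e1, e2, Real.Gamma_nat_eq_factorial, Real.rpow_neg hc.le, Real.rpow_natCast] at h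
  simp only [Real.rpow_natCast, Real.rpow_two] at h
  rw [h]
  field_simp

/-- The Bochner integral of a non-integrable function is 0, whereas the value just computed is
positive. -/
theorem integrable_norm_pow_mul_gaussian (k : ℕ) {c : ℝ} (hc : 0 < c) :
    Integrable fun z : ℂ => ‖z‖ ^ (2 * k) * Real.exp (-c * ‖z‖ ^ 2) := by
  by_contra h
  have h1 := integral_norm_pow_mul_gaussian k hc
  rw [integral_undef h] at h1
  have : 0 < Real.pi * k.factorial / c ^ (k + 1) := by positivity
  linarith

theorem lintegral_norm_pow_mul_gaussian (k : ℕ) {c : ℝ} (hc : 0 < c) :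
    ∫⁻ z : ℂ, ENNReal.ofReal (‖z‖ ^ (2 * k) * Real.exp (-c * ‖z‖ ^ 2)) =
      ENNReal.ofReal (Real.pi * k.factorial / c ^ (k + 1)) := by
  rw [← ofReal_integral_eq_lintegral_ofReal (integrable_norm_pow_mul_gaussian k hc)
    (Filter.Eventually.of_forall fun z => by positivity), integral_norm_pow_mul_gaussian k hc]

/-! ### Power series on circles and their Gaussian moments. -/

/-- Two functions with the same integral over every circle about the origin have the same integral
over the plane. -/
theorem lintegral_eq_of_circle {φ ψ : ℂ → ℝ≥0∞} (hφ : Measurable φ) (hψ : Measurable ψ)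
    (h : ∀ r : ℝ, 0 < r →
      ∫⁻ θ in Set.Ioo (-Real.pi) Real.pi, φ (Complex.polarCoord.symm (r, θ)) =
        ∫⁻ θ in Set.Ioo (-Real.pi) Real.pi, ψ (Complex.polarCoord.symm (r, θ))) :
    ∫⁻ z, φ z = ∫⁻ z, ψ z := by
  have hm : Measurable fun p : ℝ × ℝ => Complex.polarCoord.symm p := by
    simp only [Complex.polarCoord_symm_apply]
    fun_prop
  have key : ∀ χ : ℂ → ℝ≥0∞, Measurable χ → ∫⁻ z, χ z =
      ∫⁻ r in Set.Ioi (0 : ℝ), ENNReal.ofReal r *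
        ∫⁻ θ in Set.Ioo (-Real.pi) Real.pi, χ (Complex.polarCoord.symm (r, θ)) := by
    intro χ hχ
    rw [← Complex.lintegral_comp_polarCoord_symm, polarCoord_target, Measure.volume_eq_prod,
      ← Measure.prod_restrict, lintegral_prod]
    · refine lintegral_congr fun r => ?_
      simp only [smul_eq_mul]
      rw [lintegral_const_mul]
      exact hχ.comp (hm.comp measurable_prodMk_left)
    · exact ((ENNReal.measurable_ofReal.comp measurable_fst).smul (hχ.comp hm)).aemeasurable
  rw [key φ hφ, key ψ hψ]
  refine setLIntegral_congr_fun measurableSet_Ioi fun r hr => ?_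
  simp only [h r hr]

theorem integral_cexp_int_mul (n : ℤ) :
    ∫ θ in -Real.pi..Real.pi, Complex.exp (n * θ * Complex.I) =
      if n = 0 then ((2 * Real.pi : ℝ) : ℂ) else 0 := by
  split_ifs with h
  · subst h
    simp
    ring
  · have h' : (n * Complex.I : ℂ) ≠ 0 := mul_ne_zero (by exact_mod_cast h) Complex.I_ne_zero
    have := integral_exp_mul_complex (a := -Real.pi) (b := Real.pi) h'
    have e : ∀ θ : ℝ, (n * θ * Complex.I : ℂ) = n * Complex.I * θ := fun θ => by ring
    simp only [e]
    rw [this, div_eq_zero_iff]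
    left
    rw [sub_eq_zero, Complex.exp_eq_exp_iff_exists_int]
    exact ⟨n, by push_cast; ring⟩

/-- The Fourier coefficients of a power series on a circle. -/
theorem integral_circle_mul_conj_powerSeries {b : ℕ → ℂ} {g : ℂ → ℂ}
    (hg : ∀ z, HasSum (fun n => b n * z ^ n) (g z)) {r : ℝ} (m : ℕ) :
    ∫ θ in -Real.pi..Real.pi, Complex.exp (-(m * θ * Complex.I)) *
      g (r * Complex.exp (θ * Complex.I)) = (2 * Real.pi : ℝ) * (b m * r ^ m) := by
  have hs : Summable fun n => ‖b n * (r : ℂ) ^ n‖ := (hg r).summable.norm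
  have h := intervalIntegral.hasSum_integral_of_dominated_convergence
    (μ := volume) (a := -Real.pi) (b := Real.pi)
    (F := fun n θ => Complex.exp (-(m * θ * Complex.I)) *
      (b n * (r * Complex.exp (θ * Complex.I)) ^ n))
    (f := fun θ => Complex.exp (-(m * θ * Complex.I)) * g (r * Complex.exp (θ * Complex.I)))
    (fun n _ => ‖b n * (r : ℂ) ^ n‖)
    (fun n => by
      apply Continuous.aestronglyMeasurable
      fun_prop)
    (fun n => Filter.Eventually.of_forall fun θ _ => by
      have : -(m * θ * Complex.I : ℂ) = ((-(m * θ) : ℝ) : ℂ) * Complex.I := by push_cast; ring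
      rw [norm_mul, this, Complex.norm_exp_ofReal_mul_I]
      simp [Complex.norm_exp_ofReal_mul_I, mul_pow])
    (Filter.Eventually.of_forall fun θ _ => hs)
    (by simp)
    (Filter.Eventually.of_forall fun θ _ => (hg _).mul_left _)
  have h2 : ∀ n : ℕ, ∫ θ in -Real.pi..Real.pi, Complex.exp (-(m * θ * Complex.I)) *
      (b n * (r * Complex.exp (θ * Complex.I)) ^ n) =
      if n = m then (2 * Real.pi : ℝ) * (b m * r ^ m) else 0 := by
    intro n
    have e : ∀ θ : ℝ, Complex.exp (-(m * θ * Complex.I)) *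
        (b n * (r * Complex.exp (θ * Complex.I)) ^ n) =
        b n * r ^ n * Complex.exp (((n - m : ℤ) : ℂ) * θ * Complex.I) := by
      intro θ
      rw [mul_pow, ← Complex.exp_nat_mul]
      have : Complex.exp (((n - m : ℤ) : ℂ) * θ * Complex.I) =
        Complex.exp (-(m * θ * Complex.I)) * Complex.exp (n * (θ * Complex.I)) := by
        rw [← Complex.exp_add]
        congr 1
        push_cast
        ring
      rw [this]
      ring
    simp only [e]
    rw [intervalIntegral.integral_const_mul, integral_cexp_int_mul]
    by_cases hnm : n = m
    · subst hnm
      simp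
      ring
    · have : (n - m : ℤ) ≠ 0 := by omega
      simp [hnm, this]
  simp only [h2] at h
  exact h.unique (hasSum_ite_eq m _)

/-- Parseval's identity for a power series on a circle. -/
theorem hasSum_integral_circle_normSq {b : ℕ → ℂ} {g : ℂ → ℂ} (hgc : Continuous g)
    (hg : ∀ z, HasSum (fun n => b n * z ^ n) (g z)) {r : ℝ} :
    HasSum (fun n => 2 * Real.pi * (‖b n‖ ^ 2 * r ^ (2 * n)))
      (∫ θ in -Real.pi..Real.pi, ‖g (r * Complex.exp (θ * Complex.I))‖ ^ 2) := by
  have hs : Summable fun n => ‖b n * (r : ℂ) ^ n‖ := (hg r).summable.norm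
  obtain ⟨C, hC⟩ : ∃ C, ∀ θ : ℝ, ‖g (r * Complex.exp (θ * Complex.I))‖ ≤ C := by
    refine ⟨∑' n, ‖b n * (r : ℂ) ^ n‖, fun θ => ?_⟩
    rw [← (hg _).tsum_eq]
    refine tsum_of_norm_bounded hs.hasSum fun n => ?_
    simp [mul_pow, Complex.norm_exp_ofReal_mul_I]
  -- Only one factor is expanded. The conjugate factor stays whole, bounded by C, so each term is a
  -- conjugated Fourier coefficient of g and no double series arises.
  have h := intervalIntegral.hasSum_integral_of_dominated_convergence
    (μ := volume) (a := -Real.pi) (b := Real.pi)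
    (F := fun n θ => (b n * (r * Complex.exp (θ * Complex.I)) ^ n) *
      (starRingEnd ℂ) (g (r * Complex.exp (θ * Complex.I))))
    (f := fun θ => g (r * Complex.exp (θ * Complex.I)) *
      (starRingEnd ℂ) (g (r * Complex.exp (θ * Complex.I))))
    (fun n _ => ‖b n * (r : ℂ) ^ n‖ * C)
    (fun n => by
      apply Continuous.aestronglyMeasurable
      have := Complex.continuous_conj
      fun_prop)
    (fun n => Filter.Eventually.of_forall fun θ _ => by
      rw [norm_mul, RCLike.norm_conj]
      refine mul_le_mul ?_ (hC θ) (norm_nonneg _) (norm_nonneg _)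
      simp [Complex.norm_exp_ofReal_mul_I, mul_pow])
    (Filter.Eventually.of_forall fun θ _ => hs.mul_right _)
    (by simp)
    (Filter.Eventually.of_forall fun θ _ => (hg _).mul_right _)
  have h2 : ∀ n : ℕ, ∫ θ in -Real.pi..Real.pi, (b n * (r * Complex.exp (θ * Complex.I)) ^ n) *
      (starRingEnd ℂ) (g (r * Complex.exp (θ * Complex.I))) =
      ((2 * Real.pi * (‖b n‖ ^ 2 * r ^ (2 * n)) : ℝ) : ℂ) := by
    intro n
    have e : ∀ θ : ℝ, (b n * (r * Complex.exp (θ * Complex.I)) ^ n) *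
        (starRingEnd ℂ) (g (r * Complex.exp (θ * Complex.I))) =
        b n * r ^ n * (starRingEnd ℂ) (Complex.exp (-(n * θ * Complex.I)) *
          g (r * Complex.exp (θ * Complex.I))) := by
      intro θ
      rw [mul_pow, ← Complex.exp_nat_mul, map_mul, ← Complex.exp_conj]
      have : (starRingEnd ℂ) (-(n * θ * Complex.I)) = n * (θ * Complex.I) := by
        simp
        ring
      rw [this]
      ring
    simp only [e]
    rw [intervalIntegral.integral_const_mul, intervalIntegral.integral_of_le (by linarith [Real.pi_pos]),
      integral_conj, ← intervalIntegral.integral_of_le (by linarith [Real.pi_pos]),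
      integral_circle_mul_conj_powerSeries hg]
    simp only [map_mul, map_pow, Complex.conj_ofReal]
    have := Complex.mul_conj' (b n)
    push_cast
    rw [← this]
    ring
  simp only [h2] at h
  have e3 : (∫ θ in -Real.pi..Real.pi, g (r * Complex.exp (θ * Complex.I)) *
      (starRingEnd ℂ) (g (r * Complex.exp (θ * Complex.I)))) =
      ((∫ θ in -Real.pi..Real.pi, ‖g (r * Complex.exp (θ * Complex.I))‖ ^ 2 : ℝ) : ℂ) := by
    rw [← intervalIntegral.integral_ofReal]
    refine intervalIntegral.integral_congr fun θ _ => ?_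
    simp only [Complex.mul_conj', Complex.ofReal_pow]
  rw [e3] at h
  exact Complex.hasSum_ofReal.1 h

/-- The Gaussian moments of an entire function in terms of its Taylor coefficients. -/
theorem lintegral_gaussian_moment {b : ℕ → ℂ} {g : ℂ → ℂ} (hgc : Continuous g)
    (hg : ∀ z, HasSum (fun n => b n * z ^ n) (g z)) (q : ℕ) {c : ℝ} (hc : 0 < c) :
    ∫⁻ z, ENNReal.ofReal (‖z‖ ^ (2 * q) * ‖g z‖ ^ 2 * Real.exp (-c * ‖z‖ ^ 2)) =
      ∑' n, ENNReal.ofReal (‖b n‖ ^ 2 * (Real.pi * (n + q).factorial / c ^ (n + q + 1))) := by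
  have hterm : ∀ n, ENNReal.ofReal (‖b n‖ ^ 2 * (Real.pi * (n + q).factorial / c ^ (n + q + 1))) =
      ∫⁻ z : ℂ, ENNReal.ofReal (‖b n‖ ^ 2 * ‖z‖ ^ (2 * n) *
        (‖z‖ ^ (2 * q) * Real.exp (-c * ‖z‖ ^ 2))) := by
    intro n
    rw [ENNReal.ofReal_mul (by positivity), ← lintegral_norm_pow_mul_gaussian (n + q) hc,
      ← lintegral_const_mul _ (by fun_prop)]
    refine lintegral_congr fun z => ?_
    rw [← ENNReal.ofReal_mul (by positivity)]
    congr 1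
    ring
  simp only [hterm]
  rw [← lintegral_tsum (fun n => by fun_prop)]
  -- The weight is constant on each circle, so Parseval suffices there. Both sides may be infinite,
  -- so no integrability of g is needed.
  refine lintegral_eq_of_circle (by fun_prop) (Measurable.tsum fun n => by fun_prop) ?_
  intro r hr
  have hz : ∀ θ : ℝ, Complex.polarCoord.symm (r, θ) = r * Complex.exp (θ * Complex.I) := by
    intro θ
    rw [Complex.polarCoord_symm_apply, Complex.exp_mul_I, Complex.ofReal_cos, Complex.ofReal_sin]
  have hn : ∀ θ : ℝ, ‖(r * Complex.exp (θ * Complex.I) : ℂ)‖ = r := by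
    intro θ
    simp [Complex.norm_exp_ofReal_mul_I, abs_of_pos hr]
  simp only [hz, hn]
  set w : ℝ := r ^ (2 * q) * Real.exp (-c * r ^ 2) with hw
  have hw0 : 0 ≤ w := by positivity
  have hP := hasSum_integral_circle_normSq hgc hg (r := r)
  have hint : Integrable (fun θ : ℝ => r ^ (2 * q) * ‖g (r * Complex.exp (θ * Complex.I))‖ ^ 2 *
      Real.exp (-c * r ^ 2)) (volume.restrict (Set.Ioo (-Real.pi) Real.pi)) := by
    refine IntegrableOn.mono_set (Continuous.integrableOn_Ioc ?_) Set.Ioo_subset_Ioc_self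
    fun_prop
  rw [← ofReal_integral_eq_lintegral_ofReal hint
    (Filter.Eventually.of_forall fun θ => by positivity), lintegral_const]
  have e1 : ∫ θ in Set.Ioo (-Real.pi) Real.pi, r ^ (2 * q) *
      ‖g (r * Complex.exp (θ * Complex.I))‖ ^ 2 * Real.exp (-c * r ^ 2) =
      w * ∫ θ in -Real.pi..Real.pi, ‖g (r * Complex.exp (θ * Complex.I))‖ ^ 2 := by
    rw [← integral_Ioc_eq_integral_Ioo, ← intervalIntegral.integral_of_le
      (by linarith [Real.pi_pos]), ← intervalIntegral.integral_const_mul]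
    refine intervalIntegral.integral_congr fun θ _ => ?_
    simp only [hw]
    ring
  have hA : HasSum (fun n => ‖b n‖ ^ 2 * r ^ (2 * n) * w)
      ((∑' n, ‖b n‖ ^ 2 * r ^ (2 * n)) * w) := by
    refine HasSum.mul_right w (Summable.hasSum ?_)
    have := hP.summable
    rwa [summable_mul_left_iff (by positivity)] at this
  rw [e1, ← hP.tsum_eq, tsum_mul_left, ← ENNReal.ofReal_tsum_of_nonneg (fun n => by positivity)
    hA.summable, hA.tsum_eq, Measure.restrict_apply_univ, Real.volume_Ioo,
    ← ENNReal.ofReal_mul]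
  · congr 1
    ring
  · exact mul_nonneg (tsum_nonneg fun n => by positivity) hw0

/-! ### The gap inequality for even entire functions. -/

theorem hasSum_taylor_zero {f : ℂ → ℂ} (hf : Differentiable ℂ f) (z : ℂ) :
    HasSum (fun n : ℕ => ((n.factorial : ℂ)⁻¹ * iteratedDeriv n f 0) * z ^ n) (f z) := by
  refine (Complex.hasSum_taylorSeries_of_entire hf 0 z).congr_fun ?_
  intro n
  simp only [sub_zero, smul_eq_mul]
  ring

theorem deriv_zero_of_even {g : ℂ → ℂ} (he : ∀ z, g (-z) = g z) : deriv g 0 = 0 := by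
  have h := deriv_comp_neg g 0
  simp only [he, neg_zero] at h
  exact self_eq_neg.1 h

/-- An even entire function has no Gaussian mass of angular momentum one. -/
theorem lintegral_gaussian_even_le {g : ℂ → ℂ} (hg : Differentiable ℂ g)
    (he : ∀ z, g (-z) = g z) :
    3 * ∫⁻ z, ENNReal.ofReal (‖g z‖ ^ 2 * Real.exp (-2 * ‖z‖ ^ 2)) ≤
      (∫⁻ z, ENNReal.ofReal (2 * ‖z‖ ^ 2 * (‖g z‖ ^ 2 * Real.exp (-2 * ‖z‖ ^ 2)))) +
        ENNReal.ofReal (Real.pi * ‖g 0‖ ^ 2) := by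
  set b : ℕ → ℂ := fun n => (n.factorial : ℂ)⁻¹ * iteratedDeriv n g 0 with hb
  have hs : ∀ z, HasSum (fun n => b n * z ^ n) (g z) := hasSum_taylor_zero hg
  have b0 : b 0 = g 0 := by simp [hb]
  have b1 : b 1 = 0 := by simp [hb, deriv_zero_of_even he]
  have h0 := lintegral_gaussian_moment hg.continuous hs 0 (c := 2) two_pos
  have h1 := lintegral_gaussian_moment hg.continuous hs 1 (c := 2) two_pos
  have e0 : ∀ z, ‖z‖ ^ (2 * 0) * ‖g z‖ ^ 2 * Real.exp (-2 * ‖z‖ ^ 2) =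
    ‖g z‖ ^ 2 * Real.exp (-2 * ‖z‖ ^ 2) := fun z => by ring
  have e1 : ∀ z, ENNReal.ofReal (2 * ‖z‖ ^ 2 * (‖g z‖ ^ 2 * Real.exp (-2 * ‖z‖ ^ 2))) =
      2 * ENNReal.ofReal (‖z‖ ^ (2 * 1) * ‖g z‖ ^ 2 * Real.exp (-2 * ‖z‖ ^ 2)) := fun z => by
    rw [← ENNReal.ofReal_ofNat 2, ← ENNReal.ofReal_mul (by norm_num)]
    congr 1
    ring
  have hgc := hg.continuous
  have e2 : ENNReal.ofReal (Real.pi * ‖g 0‖ ^ 2) =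
      ∑' n : ℕ, if n = 0 then ENNReal.ofReal (Real.pi * ‖g 0‖ ^ 2) else 0 := by
    rw [tsum_ite_eq]
  simp only [e0] at h0
  simp only [e1]
  rw [lintegral_const_mul _ (by fun_prop), h0, h1, e2, ← ENNReal.tsum_mul_left,
    ← ENNReal.tsum_mul_left, ← ENNReal.tsum_add]
  refine ENNReal.tsum_le_tsum fun n => ?_
  rw [← ENNReal.ofReal_ofNat 2, ← ENNReal.ofReal_ofNat 3, ← ENNReal.ofReal_mul (by norm_num),
    ← ENNReal.ofReal_mul (by norm_num)]
  -- Termwise the claim is 3 ≤ (n + 1) + 2·[n = 0]: equality at n = 0, where π|g(0)|² is twice the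
  -- Gaussian mass of the constant term; a vanishing coefficient at n = 1; and n + 1 ≥ 3 beyond.
  rcases n with _ | _ | n
  · rw [if_pos rfl, ← ENNReal.ofReal_add (by positivity) (by positivity), b0]
    apply ENNReal.ofReal_le_ofReal
    norm_num
    nlinarith [Real.pi_pos, sq_nonneg ‖g 0‖, mul_nonneg Real.pi_pos.le (sq_nonneg ‖g 0‖)]
  · simp [b1]
  · rw [if_neg (by omega)]
    simp only [add_zero]
    apply ENNReal.ofReal_le_ofReal
    have hX : 0 ≤ ‖b (n + 1 + 1)‖ ^ 2 * (Real.pi * (n + 1 + 1).factorial / 2 ^ (n + 1 + 1 + 1)) := by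
      positivity
    have : 2 * (‖b (n + 1 + 1)‖ ^ 2 *
        (Real.pi * (n + 1 + 1 + 1).factorial / 2 ^ (n + 1 + 1 + 1 + 1))) =
        (n + 3) * (‖b (n + 1 + 1)‖ ^ 2 *
          (Real.pi * (n + 1 + 1).factorial / 2 ^ (n + 1 + 1 + 1))) := by
      rw [Nat.factorial_succ (n + 1 + 1), pow_succ _ (n + 1 + 1 + 1)]
      push_cast
      field_simp
      ring
    rw [this]
    have hn : (0 : ℝ) ≤ n := n.cast_nonneg
    nlinarith [mul_nonneg hn hX]

/-! ### The pair density and the sharp quartic inequality. -/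

/-- Centre of mass and relative coordinates. -/
theorem lintegral_add_sub {Φ : ℂ × ℂ → ℝ≥0∞} (hΦ : Measurable Φ) :
    4 * ∫⁻ s, ∫⁻ t, Φ (s + t, s - t) = ∫⁻ z, ∫⁻ w, Φ (z, w) := by
  have m1 : Measurable (Function.uncurry fun s t : ℂ => Φ (s + t, s - t)) :=
    hΦ.comp (g := Φ) (f := fun p : ℂ × ℂ => (p.1 + p.2, p.1 - p.2)) (by fun_prop)
  have m2 : Measurable (Function.uncurry fun t z : ℂ => Φ (z, z - 2 * t)) :=
    hΦ.comp (g := Φ) (f := fun p : ℂ × ℂ => (p.2, p.2 - 2 * p.1)) (by fun_prop)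
  have m3 : Measurable (Function.uncurry fun z t : ℂ => Φ (z, z - 2 * t)) :=
    hΦ.comp (g := Φ) (f := fun p : ℂ × ℂ => (p.1, p.1 - 2 * p.2)) (by fun_prop)
  rw [lintegral_lintegral_swap m1.aemeasurable]
  have h1 : ∀ t : ℂ, ∫⁻ s, Φ (s + t, s - t) = ∫⁻ z, Φ (z, z - 2 * t) := by
    intro t
    rw [← lintegral_add_right_eq_self (fun z => Φ (z, z - 2 * t)) t]
    refine lintegral_congr fun s => ?_
    congr 2
    ring
  simp only [h1]
  rw [lintegral_lintegral_swap m2.aemeasurable, ← lintegral_const_mul _ m3.lintegral_prod_right]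
  refine lintegral_congr fun z => ?_
  have hm : Measurable fun w => Φ (z, w) := hΦ.comp (by fun_prop)
  -- The substitution w = z - 2t scales a real plane by 2, so its Jacobian is the factor 4.
  have h2 := Measure.map_addHaar_smul (volume : Measure ℂ) (r := -2) (by norm_num)
  rw [Complex.finrank_real_complex] at h2
  have h3 : ∫⁻ t, Φ (z, z - 2 * t) =
      ∫⁻ w, Φ (z, z + w) ∂(Measure.map ((-2 : ℝ) • ·) (volume : Measure ℂ)) := by
    have m4 : Measurable fun w => Φ (z, z + w) := hΦ.comp (by fun_prop)
    rw [lintegral_map m4 (measurable_const_smul (-2 : ℝ))]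
    refine lintegral_congr fun t => ?_
    congr 2
    simp [Complex.real_smul]
    ring
  rw [h3, h2, lintegral_smul_measure, lintegral_add_left_eq_self (fun w => Φ (z, w)) z,
    smul_eq_mul, ← mul_assoc, ← ENNReal.ofReal_ofNat 4, ← ENNReal.ofReal_mul (by norm_num)]
  norm_num

/-- The density `|f|² exp (-|z|²)`. -/
noncomputable def density (f : ℂ → ℂ) (z : ℂ) : ℝ := ‖f z‖ ^ 2 * Real.exp (-‖z‖ ^ 2)

theorem density_nonneg (f : ℂ → ℂ) (z : ℂ) : 0 ≤ density f z := by
  unfold density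
  positivity

theorem continuous_density {f : ℂ → ℂ} (hf : Continuous f) : Continuous (density f) := by
  unfold density
  fun_prop

theorem density_add_mul_density_sub (f : ℂ → ℂ) (s t : ℂ) :
    density f (s + t) * density f (s - t) =
      Real.exp (-2 * ‖s‖ ^ 2) * (‖f (s + t) * f (s - t)‖ ^ 2 * Real.exp (-2 * ‖t‖ ^ 2)) := by
  have h := parallelogram_law_with_norm ℝ s t
  have e : Real.exp (-‖s + t‖ ^ 2) * Real.exp (-‖s - t‖ ^ 2) =
      Real.exp (-2 * ‖s‖ ^ 2) * Real.exp (-2 * ‖t‖ ^ 2) := by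
    rw [← Real.exp_add, ← Real.exp_add]
    congr 1
    nlinarith
  unfold density
  rw [norm_mul, mul_pow]
  linear_combination (‖f (s + t)‖ ^ 2 * ‖f (s - t)‖ ^ 2) * e

/-- For fixed s this is the gap inequality for the even function t ↦ f(s+t)f(s-t), multiplied by
exp(-2|s|²); its value at t = 0 produces ρ(s)². -/
theorem lintegral_density_relative_le {f : ℂ → ℂ} (hf : Differentiable ℂ f) (s : ℂ) :
    3 * ∫⁻ t, ENNReal.ofReal (density f (s + t) * density f (s - t)) ≤
      (∫⁻ t, ENNReal.ofReal (2 * ‖t‖ ^ 2 * (density f (s + t) * density f (s - t)))) +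
        ENNReal.ofReal (Real.pi * density f s ^ 2) := by
  have hfc := hf.continuous
  have hE : 0 ≤ Real.exp (-2 * ‖s‖ ^ 2) := (Real.exp_pos _).le
  have h := lintegral_gaussian_even_le (g := fun t => f (s + t) * f (s - t)) (by fun_prop)
    (fun z => by simp only [sub_neg_eq_add, ← sub_eq_add_neg]; ring)
  have h' := mul_le_mul_right h (ENNReal.ofReal (Real.exp (-2 * ‖s‖ ^ 2)))
  rw [mul_add, mul_left_comm, ← lintegral_const_mul (ENNReal.ofReal (Real.exp (-2 * ‖s‖ ^ 2)))
    (by fun_prop), ← lintegral_const_mul (ENNReal.ofReal (Real.exp (-2 * ‖s‖ ^ 2)))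
    (by fun_prop), ← ENNReal.ofReal_mul hE] at h'
  simp only [← ENNReal.ofReal_mul hE] at h'
  convert h' using 3
  · funext t
    rw [density_add_mul_density_sub]
  · funext t
    rw [density_add_mul_density_sub]
    congr 1
    ring
  · have e := density_add_mul_density_sub f s 0
    simp only [add_zero, sub_zero, norm_zero] at e ⊢
    rw [pow_two, e]
    norm_num
    ring

theorem lintegral_density_pair_le {f : ℂ → ℂ} (hf : Differentiable ℂ f) :
    3 * ∫⁻ z, ∫⁻ w, ENNReal.ofReal (density f z * density f w) ≤
      (∫⁻ z, ∫⁻ w, ENNReal.ofReal (‖z - w‖ ^ 2 / 2 * (density f z * density f w))) +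
        4 * ∫⁻ s, ENNReal.ofReal (Real.pi * density f s ^ 2) := by
  have hd := continuous_density hf.continuous
  rw [← lintegral_add_sub (Φ := fun p => ENNReal.ofReal (density f p.1 * density f p.2))
    (by fun_prop), ← lintegral_add_sub (Φ := fun p =>
      ENNReal.ofReal (‖p.1 - p.2‖ ^ 2 / 2 * (density f p.1 * density f p.2))) (by fun_prop),
    mul_left_comm, ← mul_add]
  have hm : Measurable fun s => ENNReal.ofReal (Real.pi * density f s ^ 2) := by fun_prop
  rw [← lintegral_add_right _ hm, ← lintegral_const_mul _ (by
    apply Measurable.lintegral_prod_right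
    fun_prop)]
  gcongr with s
  refine (lintegral_density_relative_le hf s).trans (le_of_eq ?_)
  congr 1
  refine lintegral_congr fun t => ?_
  have : s + t - (s - t) = 2 * t := by ring
  simp only [this, norm_mul, Complex.norm_ofNat]
  congr 1
  ring

theorem integral_four_terms {p₁ p₂ p₃ p₄ : ℂ → ℝ} (h₁ : Integrable p₁) (h₂ : Integrable p₂)
    (h₃ : Integrable p₃) (h₄ : Integrable p₄) (a b c d : ℝ) :
    Integrable (fun z => a * p₁ z + b * p₂ z - (c * p₃ z + d * p₄ z)) ∧
      ∫ z, (a * p₁ z + b * p₂ z - (c * p₃ z + d * p₄ z)) =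
        a * (∫ z, p₁ z) + b * (∫ z, p₂ z) - (c * (∫ z, p₃ z) + d * ∫ z, p₄ z) := by
  have i₁ : Integrable fun z => a * p₁ z + b * p₂ z := (h₁.const_mul a).add (h₂.const_mul b)
  have i₂ : Integrable fun z => c * p₃ z + d * p₄ z := (h₃.const_mul c).add (h₄.const_mul d)
  refine ⟨i₁.sub i₂, ?_⟩
  rw [integral_sub i₁ i₂, integral_add (h₁.const_mul a) (h₂.const_mul b),
    integral_add (h₃.const_mul c) (h₄.const_mul d)]
  simp only [integral_const_mul]

/-- Expanding |z-w|² gives exactly KM - (X² + Y²), where (X, Y) is the first moment of ρ, and the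
square is dropped. The loss vanishes when the centre of mass is 0. -/
theorem lintegral_normSq_sub_mul_le {ρ : ℂ → ℝ} (h0 : ∀ z, 0 ≤ ρ z) (hρ : Integrable ρ)
    (hK : Integrable fun z => ‖z‖ ^ 2 * ρ z) :
    ∫⁻ z, ∫⁻ w, ENNReal.ofReal (‖z - w‖ ^ 2 / 2 * (ρ z * ρ w)) ≤
      ENNReal.ofReal ((∫ z, ‖z‖ ^ 2 * ρ z) * ∫ z, ρ z) := by
  have hQ : ∀ a b : ℝ, Integrable fun z : ℂ => (a * z.re + b * z.im) * ρ z := by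
    intro a b
    refine ((hρ.add hK).const_mul (|a| + |b|)).mono' ?_ (Filter.Eventually.of_forall fun z => ?_)
    · exact AEStronglyMeasurable.mul (by fun_prop) hρ.1
    · simp only [Pi.add_apply]
      rw [norm_mul, Real.norm_eq_abs, Real.norm_eq_abs, abs_of_nonneg (h0 z)]
      have h1 : |a * z.re + b * z.im| ≤ (|a| + |b|) * ‖z‖ := by
        refine (abs_add_le _ _).trans ?_
        rw [abs_mul, abs_mul, add_mul]
        exact add_le_add (mul_le_mul_of_nonneg_left (Complex.abs_re_le_norm z) (abs_nonneg _))
          (mul_le_mul_of_nonneg_left (Complex.abs_im_le_norm z) (abs_nonneg _))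
      have h2 : ‖z‖ ≤ 1 + ‖z‖ ^ 2 := by nlinarith [sq_nonneg (‖z‖ - 1)]
      calc |a * z.re + b * z.im| * ρ z ≤ ((|a| + |b|) * (1 + ‖z‖ ^ 2)) * ρ z := by
            refine mul_le_mul_of_nonneg_right (h1.trans ?_) (h0 z)
            exact mul_le_mul_of_nonneg_left h2 (by positivity)
        _ = (|a| + |b|) * (ρ z + ‖z‖ ^ 2 * ρ z) := by ring
  set M := ∫ z, ρ z with hM
  set K := ∫ z, ‖z‖ ^ 2 * ρ z with hKd
  set X := ∫ z, z.re * ρ z with hX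
  set Y := ∫ z, z.im * ρ z with hY
  have hXi : Integrable fun z : ℂ => z.re * ρ z := by simpa using hQ 1 0
  have hYi : Integrable fun z : ℂ => z.im * ρ z := by simpa using hQ 0 1
  have inner : ∀ z : ℂ, ∫⁻ w, ENNReal.ofReal (‖z - w‖ ^ 2 / 2 * (ρ z * ρ w)) =
      ENNReal.ofReal (ρ z * ((‖z‖ ^ 2 * M + K) / 2 - (z.re * X + z.im * Y))) := by
    intro z
    have e : ∀ w, ‖z - w‖ ^ 2 / 2 * (ρ z * ρ w) =
        ρ z * ((‖z‖ ^ 2 / 2 * ρ w + 1 / 2 * (‖w‖ ^ 2 * ρ w)) -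
          (z.re * (w.re * ρ w) + z.im * (w.im * ρ w))) := by
      intro w
      rw [Complex.sq_norm, Complex.sq_norm, Complex.sq_norm, Complex.normSq_apply,
        Complex.normSq_apply, Complex.normSq_apply, Complex.sub_re, Complex.sub_im]
      ring
    have i := integral_four_terms hρ hK hXi hYi (‖z‖ ^ 2 / 2) (1 / 2) z.re z.im
    have hi : Integrable fun w => ‖z - w‖ ^ 2 / 2 * (ρ z * ρ w) := by
      simp only [e]
      exact i.1.const_mul (ρ z)
    rw [← ofReal_integral_eq_lintegral_ofReal hi (Filter.Eventually.of_forall fun w =>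
      mul_nonneg (by positivity) (mul_nonneg (h0 z) (h0 w)))]
    congr 1
    simp only [e]
    rw [integral_const_mul, i.2]
    ring
  simp only [inner]
  have e : ∀ z : ℂ, ρ z * ((‖z‖ ^ 2 * M + K) / 2 - (z.re * X + z.im * Y)) =
      (M / 2 * (‖z‖ ^ 2 * ρ z) + K / 2 * ρ z) - (X * (z.re * ρ z) + Y * (z.im * ρ z)) := by
    intro z
    ring
  have i := integral_four_terms hK hρ hXi hYi (M / 2) (K / 2) X Y
  have hi : Integrable fun z => ρ z * ((‖z‖ ^ 2 * M + K) / 2 - (z.re * X + z.im * Y)) := by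
    simp only [e]
    exact i.1
  -- This expression is the integral of |z-w|²ρ(w)/2 over w, hence nonnegative.
  have hnn : ∀ z : ℂ, 0 ≤ (‖z‖ ^ 2 * M + K) / 2 - (z.re * X + z.im * Y) := by
    intro z
    have e' : ∀ w : ℂ, ‖z - w‖ ^ 2 / 2 * ρ w =
        (‖z‖ ^ 2 / 2 * ρ w + 1 / 2 * (‖w‖ ^ 2 * ρ w)) -
          (z.re * (w.re * ρ w) + z.im * (w.im * ρ w)) := by
      intro w
      rw [Complex.sq_norm, Complex.sq_norm, Complex.sq_norm, Complex.normSq_apply,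
        Complex.normSq_apply, Complex.normSq_apply, Complex.sub_re, Complex.sub_im]
      ring
    have hp : 0 ≤ ∫ w, ‖z - w‖ ^ 2 / 2 * ρ w :=
      integral_nonneg fun w => mul_nonneg (by positivity) (h0 w)
    simp only [e'] at hp
    rw [(integral_four_terms hρ hK hXi hYi (‖z‖ ^ 2 / 2) (1 / 2) z.re z.im).2] at hp
    linarith
  rw [← ofReal_integral_eq_lintegral_ofReal hi
    (Filter.Eventually.of_forall fun z => mul_nonneg (h0 z) (hnn z))]
  apply ENNReal.ofReal_le_ofReal
  simp only [e]
  rw [i.2]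
  nlinarith [sq_nonneg X, sq_nonneg Y]

/-- The sharp lower bound of the Hamiltonian by mass and angular momentum. -/
theorem mass_sq_le {f : ℂ → ℂ} (hf : Differentiable ℂ f) (hρ : Integrable (density f))
    (hK : Integrable fun z => ‖z‖ ^ 2 * density f z)
    (hH : Integrable fun z => density f z ^ 2) :
    3 * (∫ z, density f z) ^ 2 ≤ (∫ z, ‖z‖ ^ 2 * density f z) * (∫ z, density f z) +
      4 * Real.pi * ∫ z, density f z ^ 2 := by
  have h0 := density_nonneg f
  have hd := continuous_density hf.continuous
  have hM0 : 0 ≤ ∫ z, density f z := integral_nonneg h0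
  have hK0 : 0 ≤ ∫ z, ‖z‖ ^ 2 * density f z :=
    integral_nonneg fun z => mul_nonneg (by positivity) (h0 z)
  have hH0 : 0 ≤ ∫ z, density f z ^ 2 := integral_nonneg fun z => sq_nonneg _
  have h := (lintegral_density_pair_le hf).trans
    (add_le_add_left (lintegral_normSq_sub_mul_le h0 hρ hK) _)
  have e1 : ∫⁻ z, ∫⁻ w, ENNReal.ofReal (density f z * density f w) =
      ENNReal.ofReal ((∫ z, density f z) ^ 2) := by
    have : ∀ z, ∫⁻ w, ENNReal.ofReal (density f z * density f w) =
        ENNReal.ofReal (density f z) * ENNReal.ofReal (∫ z, density f z) := by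
      intro z
      rw [ofReal_integral_eq_lintegral_ofReal hρ (Filter.Eventually.of_forall h0),
        ← lintegral_const_mul _ (by fun_prop)]
      simp only [ENNReal.ofReal_mul (h0 z)]
    simp only [this]
    rw [lintegral_mul_const _ (by fun_prop),
      ← ofReal_integral_eq_lintegral_ofReal hρ (Filter.Eventually.of_forall h0), pow_two,
      ENNReal.ofReal_mul hM0]
  have e2 : ∫⁻ s, ENNReal.ofReal (Real.pi * density f s ^ 2) =
      ENNReal.ofReal (Real.pi * ∫ z, density f z ^ 2) := by
    rw [← integral_const_mul, ofReal_integral_eq_lintegral_ofReal (hH.const_mul _)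
      (Filter.Eventually.of_forall fun z => by positivity)]
  rw [e1, e2, ← ENNReal.ofReal_ofNat 3, ← ENNReal.ofReal_ofNat 4,
    ← ENNReal.ofReal_mul (by norm_num), ← ENNReal.ofReal_mul (by norm_num),
    ← ENNReal.ofReal_add (by positivity) (by positivity),
    ENNReal.ofReal_le_ofReal_iff (by positivity)] at h
  linarith

/-- The angular momentum is nonnegative and vanishes only for multiples of the Gaussian. -/
theorem integral_density_le_and_eq {f : ℂ → ℂ} (hf : Differentiable ℂ f)
    (hρ : Integrable (density f)) (hK : Integrable fun z => ‖z‖ ^ 2 * density f z) :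
    (∫ z, density f z) ≤ (∫ z, ‖z‖ ^ 2 * density f z) ∧
      ((∫ z, ‖z‖ ^ 2 * density f z) = (∫ z, density f z) → ∀ z, f z = f 0) := by
  have h0 := density_nonneg f
  set b : ℕ → ℂ := fun n => (n.factorial : ℂ)⁻¹ * iteratedDeriv n f 0 with hb
  have hs : ∀ z, HasSum (fun n => b n * z ^ n) (f z) := hasSum_taylor_zero hf
  have key : ∀ q : ℕ, Integrable (fun z => ‖z‖ ^ (2 * q) * density f z) →
      HasSum (fun n => ‖b n‖ ^ 2 * (Real.pi * (n + q).factorial))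
        (∫ z, ‖z‖ ^ (2 * q) * density f z) := by
    intro q hq
    have h1 := lintegral_gaussian_moment hf.continuous hs q (c := 1) one_pos
    have e : ∀ z, ‖z‖ ^ (2 * q) * ‖f z‖ ^ 2 * Real.exp (-1 * ‖z‖ ^ 2) =
        ‖z‖ ^ (2 * q) * density f z := by
      intro z
      rw [density, neg_one_mul, mul_assoc]
    have hnn : ∀ z, 0 ≤ ‖z‖ ^ (2 * q) * density f z :=
      fun z => mul_nonneg (by positivity) (h0 z)
    simp only [e, one_pow, div_one] at h1
    rw [← ofReal_integral_eq_lintegral_ofReal hq (Filter.Eventually.of_forall hnn)] at h1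
    have hsum : Summable fun n => ‖b n‖ ^ 2 * (Real.pi * (n + q).factorial) := by
      have ht : ∑' n, ENNReal.ofReal (‖b n‖ ^ 2 * (Real.pi * (n + q).factorial)) ≠ ⊤ := by
        rw [← h1]
        exact ENNReal.ofReal_ne_top
      have := ENNReal.summable_toReal ht
      refine this.congr fun n => ?_
      rw [ENNReal.toReal_ofReal (by positivity)]
    rw [← ENNReal.ofReal_tsum_of_nonneg (fun n => by positivity) hsum,
      ENNReal.ofReal_eq_ofReal_iff (integral_nonneg hnn)
        (tsum_nonneg fun n => by positivity)] at h1
    rw [h1]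
    exact hsum.hasSum
  have k0 := key 0 (by simpa using hρ)
  have k1 := key 1 (by simpa using hK)
  simp only [mul_zero, pow_zero, one_mul, add_zero, mul_one] at k0 k1
  have hle : ∀ n, ‖b n‖ ^ 2 * (Real.pi * n.factorial) ≤
      ‖b n‖ ^ 2 * (Real.pi * (n + 1).factorial) := by
    intro n
    gcongr
    exact Nat.le_succ n
  -- K - M is the series of the terms n·π·n!·|bₙ|² ≥ 0; if it vanishes, only b₀ survives.
  refine ⟨hasSum_le hle k0 k1, fun heq => ?_⟩
  have hz := (hasSum_zero_iff_of_nonneg (fun n => sub_nonneg.2 (hle n))).1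
    (by simpa [heq] using k1.sub k0)
  have hb0 : ∀ n, n ≠ 0 → b n = 0 := by
    intro n hn
    have h2 := congrFun hz n
    simp only [Pi.zero_apply, Nat.factorial_succ] at h2
    push_cast at h2
    have h3 : ‖b n‖ ^ 2 * (Real.pi * n.factorial * n) = 0 := by linarith
    have h4 : Real.pi * n.factorial * n ≠ 0 := by
      have : (n : ℝ) ≠ 0 := by exact_mod_cast hn
      positivity
    simpa [h4] using h3
  have hf0 : ∀ z, f z = b 0 := by
    intro z
    refine (hs z).unique ?_
    convert hasSum_single (f := fun n => b n * z ^ n) 0 (fun n hn => by simp [hb0 n hn]) using 1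
    simp
  intro z
  rw [hf0 z, hf0 0]

/-! ### The extended-real energy and its lower bound. -/

theorem extIntegral_of_integrable {g : ℂ → ℝ} (hg : Integrable g) :
    extIntegral g = ((∫ z, g z : ℝ) : EReal) := by
  have h1 : ∫⁻ z, ENNReal.ofReal (g z) ≠ ⊤ := hg.lintegral_lt_top.ne
  have h2 : ∫⁻ z, ENNReal.ofReal (-g z) ≠ ⊤ := hg.neg.lintegral_lt_top.ne
  rw [integral_eq_lintegral_pos_part_sub_lintegral_neg_part hg, EReal.coe_sub,
    EReal.coe_ennreal_toReal h1, EReal.coe_ennreal_toReal h2, extIntegral]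

theorem extIntegral_eq_top {g : ℂ → ℝ} (hm : AEStronglyMeasurable g volume)
    (hn : ∫⁻ z, ENNReal.ofReal (-g z) ≠ ⊤) (hg : ¬ Integrable g) : extIntegral g = ⊤ := by
  have h1 : ∫⁻ z, ENNReal.ofReal (g z) = ⊤ := by
    by_contra h
    apply hg
    refine ⟨hm, ?_⟩
    rw [HasFiniteIntegral]
    refine lt_of_le_of_lt (lintegral_mono (g := fun z => ENNReal.ofReal (g z) +
      ENNReal.ofReal (-g z)) fun z => ?_) ?_
    · rw [Real.enorm_eq_ofReal_abs]
      rcases le_total 0 (g z) with h0 | h0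
      · rw [abs_of_nonneg h0]
        exact le_self_add
      · rw [abs_of_nonpos h0]
        exact le_add_self
    · rw [lintegral_add_left' (by fun_prop)]
      exact ENNReal.add_lt_top.2 ⟨lt_top_iff_ne_top.2 h, lt_top_iff_ne_top.2 hn⟩
  rw [extIntegral, h1, EReal.coe_ennreal_top]
  refine EReal.top_sub ?_
  simpa using hn

theorem energy_of_integrable (μ : ℝ) {u : ℂ → ℂ} (h4 : Integrable fun z => ‖u z‖ ^ 4)
    (hP : Integrable fun z => (‖z‖ ^ 2 - 1) * ‖u z‖ ^ 2) :
    energy μ u = ((2 * Real.pi * (∫ z, ‖u z‖ ^ 4) +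
      μ * ∫ z, (‖z‖ ^ 2 - 1) * ‖u z‖ ^ 2 : ℝ) : EReal) := by
  rw [energy, hamiltonian, angularMomentum, extIntegral_of_integrable h4,
    extIntegral_of_integrable hP]
  norm_cast
  ring

theorem norm_sq_eq_density {u f : ℂ → ℂ} (hu : ∀ z, u z = (Real.exp (-‖z‖ ^ 2 / 2) : ℂ) * f z)
    (z : ℂ) : ‖u z‖ ^ 2 = density f z := by
  rw [hu, norm_mul, mul_pow, Complex.norm_real, Real.norm_of_nonneg (Real.exp_pos _).le,
    ← Real.exp_nat_mul, density, mul_comm]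
  congr 2
  push_cast
  ring

/-- The negative part of (|z|² - 1)|u|² is at most |u|², so for μ > 0 neither summand is ⊥. This
must be checked because ⊤ + ⊥ = ⊥ in `EReal`. -/
theorem energy_eq_top_or_integrable {μ : ℝ} (hμ : 0 < μ) {u : ℂ → ℂ} (hc : Continuous u)
    (hM : Integrable fun z => ‖u z‖ ^ 2) :
    energy μ u = ⊤ ∨ (Integrable (fun z => ‖u z‖ ^ 4) ∧
      Integrable fun z => (‖z‖ ^ 2 - 1) * ‖u z‖ ^ 2) := by
  have hneg : ∫⁻ z, ENNReal.ofReal (-((‖z‖ ^ 2 - 1) * ‖u z‖ ^ 2)) ≠ ⊤ := by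
    refine ((lintegral_mono fun z => ENNReal.ofReal_le_ofReal ?_).trans_lt
      hM.lintegral_lt_top).ne
    nlinarith [mul_nonneg (sq_nonneg ‖z‖) (sq_nonneg ‖u z‖)]
  have hPb : (μ : EReal) * angularMomentum u ≠ ⊥ := by
    by_cases hP : Integrable fun z => (‖z‖ ^ 2 - 1) * ‖u z‖ ^ 2
    · rw [angularMomentum, extIntegral_of_integrable hP, ← EReal.coe_mul]
      exact EReal.coe_ne_bot _
    · rw [angularMomentum, extIntegral_eq_top (by fun_prop) hneg hP, EReal.coe_mul_top_of_pos hμ]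
      exact top_ne_bot
  by_cases h4 : Integrable fun z => ‖u z‖ ^ 4
  · by_cases hP : Integrable fun z => (‖z‖ ^ 2 - 1) * ‖u z‖ ^ 2
    · exact Or.inr ⟨h4, hP⟩
    · left
      rw [energy, hamiltonian, angularMomentum, extIntegral_eq_top (by fun_prop) hneg hP,
        EReal.coe_mul_top_of_pos hμ, extIntegral_of_integrable h4, ← EReal.coe_mul,
        ← EReal.coe_mul]
      exact EReal.add_top_of_ne_bot (EReal.coe_ne_bot _)
  · left
    have hn4 : ∫⁻ z, ENNReal.ofReal (-(‖u z‖ ^ 4)) ≠ ⊤ := by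
      have : ∀ z, ENNReal.ofReal (-(‖u z‖ ^ 4)) = 0 := fun z =>
        ENNReal.ofReal_of_nonpos (by have : 0 ≤ ‖u z‖ ^ 4 := by positivity
                                     linarith)
      simp [this]
    rw [energy, hamiltonian, extIntegral_eq_top (by fun_prop) hn4 h4,
      EReal.coe_mul_top_of_pos (by norm_num),
      EReal.coe_mul_top_of_pos (by have := Real.pi_pos; positivity)]
    exact EReal.top_add_of_ne_bot hPb

theorem eq_phaseRotation_of_const {u : ℂ → ℂ} {C : ℂ}
    (hu : ∀ z, u z = (Real.exp (-‖z‖ ^ 2 / 2) : ℂ) * C) (hM : mass u = 1) :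
    ∃ γ : ℝ, u = phaseRotation γ phi0 := by
  have hI := integral_norm_pow_mul_gaussian 0 (c := 1) one_pos
  have hC : ‖C‖ ^ 2 * Real.pi = 1 := by
    rw [← hM, mass]
    simp only [norm_sq_eq_density (f := fun _ => C) hu, density, integral_const_mul]
    congr 1
    simpa using hI.symm
  have hC' : ‖C‖ = 1 / Real.sqrt Real.pi := by
    rw [eq_div_iff (by have := Real.pi_pos; positivity)]
    have h1 : (‖C‖ * Real.sqrt Real.pi) ^ 2 = 1 := by
      rw [mul_pow, Real.sq_sqrt Real.pi_pos.le, hC]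
    exact (pow_eq_one_iff_of_nonneg (by positivity) two_ne_zero).1 h1
  refine ⟨C.arg, funext fun z => ?_⟩
  have := Complex.norm_mul_exp_arg_mul_I C
  rw [hu, phaseRotation, phi0, mul_comm Complex.I]
  conv_lhs => rw [← this, hC']
  push_cast
  ring

/-- For `μ > 1/2` the energy is at least one, with equality only at the phases of the Gaussian. -/
theorem one_le_energy {μ : ℝ} (hμ : 1 / 2 < μ) {u : ℂ → ℂ} (hu : u ∈ bargmannFock)
    (hM : mass u = 1) :
    1 ≤ energy μ u ∧ (energy μ u = 1 → ∃ γ : ℝ, u = phaseRotation γ phi0) := by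
  obtain ⟨⟨f, hf, huf⟩, hL⟩ := hu
  have hfc := hf.continuous
  have hc : Continuous u := by
    rw [funext huf]
    fun_prop
  have hM2 : Integrable fun z => ‖u z‖ ^ 2 := (memLp_two_iff_integrable_sq_norm hL.1).1 hL
  rcases energy_eq_top_or_integrable (μ := μ) (by linarith) hc hM2 with h | ⟨h4, hP⟩
  · rw [h]
    exact ⟨le_top, fun h => absurd h (by decide)⟩
  rw [energy_of_integrable μ h4 hP]
  have h2 := norm_sq_eq_density huf
  have e4 : ∀ z, ‖u z‖ ^ 4 = density f z ^ 2 := fun z => by rw [← h2]; ring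
  have hK : Integrable fun z => ‖z‖ ^ 2 * density f z := by
    refine (hP.add hM2).congr (Filter.Eventually.of_forall fun z => ?_)
    simp only [Pi.add_apply, h2]
    ring
  simp only [e4] at h4
  simp only [mass, h2] at hM
  simp only [h2] at hM2 hP
  have hPK : ∫ z, (‖z‖ ^ 2 - 1) * density f z =
      (∫ z, ‖z‖ ^ 2 * density f z) - ∫ z, density f z := by
    rw [← integral_sub hK hM2]
    exact integral_congr_ae (Filter.Eventually.of_forall fun z => by ring)
  simp only [e4, h2, hPK]
  have key := mass_sq_le hf hM2 hK h4
  obtain ⟨hle, heq⟩ := integral_density_le_and_eq hf hM2 hK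
  rw [hM] at key hle heq ⊢
  set K := ∫ z, ‖z‖ ^ 2 * density f z
  set H := ∫ z, density f z ^ 2
  constructor
  · norm_cast
    -- `key` gives 2πH ≥ 1 - (K - 1)/2, and (μ - 1/2)(K - 1) ≥ 0.
    nlinarith
  · intro h
    have h' : 2 * Real.pi * H + μ * (K - 1) = 1 := by exact_mod_cast h
    have hK1 : K = 1 := by nlinarith
    have hconst := heq hK1
    refine eq_phaseRotation_of_const (C := f 0) (fun z => by rw [huf, hconst]) ?_
    simp only [mass, h2, hM]

/-! ### Explicit competitors: translated combinations of φ₀ and φ₁. -/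

theorem integral_odd_eq_zero {h : ℂ → ℝ} (ho : ∀ z, h (-z) = -h z) : ∫ z, h z = 0 := by
  have := integral_neg_eq_self h volume
  simp only [ho, integral_neg] at this
  linarith

/-- Gaussian integrals of the polynomials of degree at most four used below. -/
theorem gaussian_polynomial {c : ℝ} (hc : 0 < c) (p₀ p₁ p₂ p₃ p₄ p₅ : ℝ) :
    Integrable (fun z : ℂ => (p₀ + p₁ * z.re + p₂ * ‖z‖ ^ 2 + p₃ * z.re ^ 2 +
      p₄ * (z.re * ‖z‖ ^ 2) + p₅ * ‖z‖ ^ 4) * Real.exp (-c * ‖z‖ ^ 2)) ∧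
    ∫ z : ℂ, (p₀ + p₁ * z.re + p₂ * ‖z‖ ^ 2 + p₃ * z.re ^ 2 +
      p₄ * (z.re * ‖z‖ ^ 2) + p₅ * ‖z‖ ^ 4) * Real.exp (-c * ‖z‖ ^ 2) =
      Real.pi * (p₀ / c + (p₂ + p₃ / 2) / c ^ 2 + 2 * p₅ / c ^ 3) := by
  have j0 := integrable_norm_pow_mul_gaussian 0 hc
  have j2 := integrable_norm_pow_mul_gaussian 1 hc
  have j4 := integrable_norm_pow_mul_gaussian 2 hc
  have v0 := integral_norm_pow_mul_gaussian 0 hc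
  have v2 := integral_norm_pow_mul_gaussian 1 hc
  have v4 := integral_norm_pow_mul_gaussian 2 hc
  norm_num at j0 j2 j4 v0 v2 v4
  simp only [← neg_mul] at j0 j2 j4 v0 v2 v4
  have hre : ∀ z : ℂ, |z.re| ≤ 1 + ‖z‖ ^ 2 := fun z => by
    nlinarith [Complex.abs_re_le_norm z, sq_nonneg (‖z‖ - 1)]
  have jx : Integrable fun z : ℂ => z.re * Real.exp (-c * ‖z‖ ^ 2) := by
    refine (j0.add j2).mono' (by fun_prop) (Filter.Eventually.of_forall fun z => ?_)
    rw [norm_mul, Real.norm_eq_abs, Real.norm_of_nonneg (Real.exp_pos _).le]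
    simp only [Pi.add_apply]
    nlinarith [mul_le_mul_of_nonneg_right (hre z) (Real.exp_pos (-c * ‖z‖ ^ 2)).le]
  have jxr : Integrable fun z : ℂ => z.re * ‖z‖ ^ 2 * Real.exp (-c * ‖z‖ ^ 2) := by
    refine (j2.add j4).mono' (by fun_prop) (Filter.Eventually.of_forall fun z => ?_)
    rw [norm_mul, norm_mul, Real.norm_eq_abs, Real.norm_of_nonneg (Real.exp_pos _).le,
      Real.norm_of_nonneg (sq_nonneg ‖z‖)]
    simp only [Pi.add_apply]
    nlinarith [mul_le_mul_of_nonneg_right (hre z)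
      (mul_nonneg (sq_nonneg ‖z‖) (Real.exp_pos (-c * ‖z‖ ^ 2)).le)]
  have jxx : Integrable fun z : ℂ => z.re ^ 2 * Real.exp (-c * ‖z‖ ^ 2) := by
    refine j2.mono' (by fun_prop) (Filter.Eventually.of_forall fun z => ?_)
    rw [Real.norm_of_nonneg (by positivity)]
    refine mul_le_mul_of_nonneg_right ?_ (Real.exp_pos _).le
    exact sq_le_sq.2 (by simpa using Complex.abs_re_le_norm z)
  have vx : ∫ z : ℂ, z.re * Real.exp (-c * ‖z‖ ^ 2) = 0 :=
    integral_odd_eq_zero fun z => by simp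
  have vxr : ∫ z : ℂ, z.re * ‖z‖ ^ 2 * Real.exp (-c * ‖z‖ ^ 2) = 0 :=
    integral_odd_eq_zero fun z => by simp
  have vxx : ∫ z : ℂ, z.re ^ 2 * Real.exp (-c * ‖z‖ ^ 2) = Real.pi / c ^ 2 / 2 := by
    -- Rotation by i exchanges the squares of the real and imaginary parts, so each carries half the
    -- integral of |z|².
    let e : ℂ ≃ₗᵢ[ℝ] ℂ := rotation ⟨Complex.I, by simp [Submonoid.unitSphere]⟩
    have he : ∀ z, e z = Complex.I * z := fun z => rfl
    have h1 := e.measurePreserving.integral_comp e.toHomeomorph.measurableEmbedding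
      (fun z : ℂ => z.re ^ 2 * Real.exp (-c * ‖z‖ ^ 2))
    simp only [he, norm_mul, Complex.norm_I, one_mul, Complex.mul_re, Complex.I_re, zero_mul,
      Complex.I_im, zero_sub, neg_sq] at h1
    have jyy : Integrable fun z : ℂ => z.im ^ 2 * Real.exp (-c * ‖z‖ ^ 2) := by
      refine j2.mono' (by fun_prop) (Filter.Eventually.of_forall fun z => ?_)
      rw [Real.norm_of_nonneg (by positivity)]
      refine mul_le_mul_of_nonneg_right ?_ (Real.exp_pos _).le
      exact sq_le_sq.2 (by simpa using Complex.abs_im_le_norm z)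
    have h2 := integral_add jxx jyy
    rw [h1] at h2
    have h3 : ∀ z : ℂ, z.re ^ 2 * Real.exp (-c * ‖z‖ ^ 2) + z.im ^ 2 * Real.exp (-c * ‖z‖ ^ 2) =
        ‖z‖ ^ 2 * Real.exp (-c * ‖z‖ ^ 2) := fun z => by
      rw [Complex.sq_norm, Complex.normSq_apply]
      ring
    simp only [h3] at h2
    rw [v2] at h2
    linarith
  have e : ∀ z : ℂ, (p₀ + p₁ * z.re + p₂ * ‖z‖ ^ 2 + p₃ * z.re ^ 2 +
      p₄ * (z.re * ‖z‖ ^ 2) + p₅ * ‖z‖ ^ 4) * Real.exp (-c * ‖z‖ ^ 2) =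
      p₀ * Real.exp (-c * ‖z‖ ^ 2) + p₁ * (z.re * Real.exp (-c * ‖z‖ ^ 2)) +
      p₂ * (‖z‖ ^ 2 * Real.exp (-c * ‖z‖ ^ 2)) + p₃ * (z.re ^ 2 * Real.exp (-c * ‖z‖ ^ 2)) +
      p₄ * (z.re * ‖z‖ ^ 2 * Real.exp (-c * ‖z‖ ^ 2)) +
      p₅ * (‖z‖ ^ 4 * Real.exp (-c * ‖z‖ ^ 2)) := fun z => by ring
  simp only [e]
  have i1 : Integrable fun z : ℂ => p₀ * Real.exp (-c * ‖z‖ ^ 2) +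
    p₁ * (z.re * Real.exp (-c * ‖z‖ ^ 2)) := (j0.const_mul p₀).add (jx.const_mul p₁)
  have i2 : Integrable fun z : ℂ => p₀ * Real.exp (-c * ‖z‖ ^ 2) +
    p₁ * (z.re * Real.exp (-c * ‖z‖ ^ 2)) + p₂ * (‖z‖ ^ 2 * Real.exp (-c * ‖z‖ ^ 2)) :=
    i1.add (j2.const_mul p₂)
  have i3 : Integrable fun z : ℂ => p₀ * Real.exp (-c * ‖z‖ ^ 2) +
    p₁ * (z.re * Real.exp (-c * ‖z‖ ^ 2)) + p₂ * (‖z‖ ^ 2 * Real.exp (-c * ‖z‖ ^ 2)) +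
    p₃ * (z.re ^ 2 * Real.exp (-c * ‖z‖ ^ 2)) := i2.add (jxx.const_mul p₃)
  have i4 : Integrable fun z : ℂ => p₀ * Real.exp (-c * ‖z‖ ^ 2) +
    p₁ * (z.re * Real.exp (-c * ‖z‖ ^ 2)) + p₂ * (‖z‖ ^ 2 * Real.exp (-c * ‖z‖ ^ 2)) +
    p₃ * (z.re ^ 2 * Real.exp (-c * ‖z‖ ^ 2)) +
    p₄ * (z.re * ‖z‖ ^ 2 * Real.exp (-c * ‖z‖ ^ 2)) := i3.add (jxr.const_mul p₄)
  refine ⟨i4.add (j4.const_mul p₅), ?_⟩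
  rw [integral_add i4 (j4.const_mul p₅), integral_add i3 (jxr.const_mul p₄),
    integral_add i2 (jxx.const_mul p₃), integral_add i1 (j2.const_mul p₂),
    integral_add (j0.const_mul p₀) (jx.const_mul p₁)]
  simp only [integral_const_mul]
  rw [v0, v2, v4, vx, vxr, vxx]
  field_simp
  ring

/-- The combination `a φ₀ + b φ₁`, translated by `α`. -/
noncomputable def translatedPair (a b α : ℝ) (z : ℂ) : ℂ :=
  (Real.exp (-‖z‖ ^ 2 / 2) : ℂ) * ((1 / Real.sqrt Real.pi * Real.exp (-α ^ 2 / 2) : ℝ) *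
    ((a + b * (z + α)) * Complex.exp (-α * z)))

theorem translatedPair_phi0 : translatedPair 1 0 0 = phi0 := by
  funext z
  simp [translatedPair, phi0]
  ring

theorem translatedPair_phi1 : translatedPair 0 1 0 = phi1 := by
  funext z
  simp [translatedPair, phi1]
  ring

theorem continuous_translatedPair (a b α : ℝ) : Continuous (translatedPair a b α) := by
  unfold translatedPair
  fun_prop

/-- The factor exp(-αz - α²/2) makes the translation a magnetic one: the function keeps its Gaussian
times entire form, while its modulus is simply translated. -/
theorem norm_sq_translatedPair (a b α : ℝ) (z : ℂ) :
    ‖translatedPair a b α z‖ ^ 2 = 1 / Real.pi * ((a ^ 2 + 2 * a * b * (z + α).re +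
      b ^ 2 * ‖z + α‖ ^ 2) * Real.exp (-1 * ‖z + α‖ ^ 2)) := by
  have h1 : ‖Complex.exp (-α * z)‖ = Real.exp (-α * z.re) := by
    rw [Complex.norm_exp]
    congr 1
    simp
  have h2 : ‖(a + b * (z + α) : ℂ)‖ ^ 2 =
      a ^ 2 + 2 * a * b * (z + α).re + b ^ 2 * ‖z + α‖ ^ 2 := by
    rw [Complex.sq_norm, Complex.sq_norm, Complex.normSq_apply, Complex.normSq_apply]
    simp
    ring
  have h3 : Real.exp (-1 * ‖z + α‖ ^ 2) = (Real.exp (-‖z‖ ^ 2 / 2) * Real.exp (-α ^ 2 / 2) *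
      Real.exp (-α * z.re)) ^ 2 := by
    rw [← Real.exp_add, ← Real.exp_add, ← Real.exp_nat_mul, Complex.sq_norm, Complex.sq_norm,
      Complex.normSq_apply, Complex.normSq_apply]
    congr 1
    simp
    ring
  have h4 : (1 / Real.sqrt Real.pi) ^ 2 = 1 / Real.pi := by
    rw [div_pow, Real.sq_sqrt Real.pi_pos.le, one_pow]
  rw [translatedPair, norm_mul, norm_mul, norm_mul, h1, Complex.norm_real, Complex.norm_real,
    Real.norm_of_nonneg (by positivity), Real.norm_of_nonneg (by positivity), h3, ← h2, ← h4]
  ring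

/-- The centre of mass of aφ₀ + bφ₁ is ab, so the shift α = ab moves it to 0. Then P = b⁴ and 8πH =
1 - b⁴/2, so the quartic inequality is attained. -/
theorem translatedPair_integrals {a b : ℝ} (hab : a ^ 2 + b ^ 2 = 1) :
    translatedPair a b (a * b) ∈ bargmannFock ∧ mass (translatedPair a b (a * b)) = 1 ∧
      ∀ μ : ℝ, energy μ (translatedPair a b (a * b)) =
        ((1 + (μ - 1 / 2) * b ^ 4 : ℝ) : EReal) := by
  set α : ℝ := a * b with hα
  have hpi := Real.pi_pos
  have hn := norm_sq_translatedPair a b α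
  have g2 := gaussian_polynomial one_pos (a ^ 2) (2 * a * b) (b ^ 2) 0 0 0
  have i2 : Integrable fun z => ‖translatedPair a b α z‖ ^ 2 := by
    simp only [hn]
    refine Integrable.const_mul ?_ _
    refine Integrable.comp_add_right (f := fun w : ℂ => (a ^ 2 + 2 * a * b * w.re +
      b ^ 2 * ‖w‖ ^ 2) * Real.exp (-1 * ‖w‖ ^ 2)) ?_ (α : ℂ)
    simpa using g2.1
  have hM : ∫ z, ‖translatedPair a b α z‖ ^ 2 = 1 := by
    simp only [hn]
    rw [integral_const_mul, integral_add_right_eq_self (fun w : ℂ => (a ^ 2 + 2 * a * b * w.re +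
      b ^ 2 * ‖w‖ ^ 2) * Real.exp (-1 * ‖w‖ ^ 2))]
    have := g2.2
    simp only [zero_mul, add_zero] at this
    rw [this]
    field_simp
    linarith
  have eP : ∀ z, (‖z‖ ^ 2 - 1) * ‖translatedPair a b α z‖ ^ 2 = 1 / Real.pi *
      ((a ^ 2 * (α ^ 2 - 1) + (2 * a * b * (α ^ 2 - 1) - 2 * α * a ^ 2) * (z + α).re +
      (a ^ 2 + b ^ 2 * (α ^ 2 - 1)) * ‖z + α‖ ^ 2 + (-4 * α * a * b) * (z + α).re ^ 2 +
      (2 * a * b - 2 * α * b ^ 2) * ((z + α).re * ‖z + α‖ ^ 2) + b ^ 2 * ‖z + α‖ ^ 4) *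
        Real.exp (-1 * ‖z + α‖ ^ 2)) := by
    intro z
    have h1 : ‖z‖ ^ 2 = ‖z + α‖ ^ 2 - 2 * α * (z + α).re + α ^ 2 := by
      rw [Complex.sq_norm, Complex.sq_norm, Complex.normSq_apply, Complex.normSq_apply]
      simp
      ring
    rw [hn, h1]
    ring
  have gP := gaussian_polynomial one_pos (a ^ 2 * (α ^ 2 - 1))
    (2 * a * b * (α ^ 2 - 1) - 2 * α * a ^ 2) (a ^ 2 + b ^ 2 * (α ^ 2 - 1)) (-4 * α * a * b)
    (2 * a * b - 2 * α * b ^ 2) (b ^ 2)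
  have iP : Integrable fun z => (‖z‖ ^ 2 - 1) * ‖translatedPair a b α z‖ ^ 2 := by
    simp only [eP]
    exact (gP.1.comp_add_right (α : ℂ)).const_mul _
  have vP : ∫ z, (‖z‖ ^ 2 - 1) * ‖translatedPair a b α z‖ ^ 2 = b ^ 4 := by
    simp only [eP]
    rw [integral_const_mul, integral_add_right_eq_self (fun w : ℂ => (a ^ 2 * (α ^ 2 - 1) +
      (2 * a * b * (α ^ 2 - 1) - 2 * α * a ^ 2) * w.re +
      (a ^ 2 + b ^ 2 * (α ^ 2 - 1)) * ‖w‖ ^ 2 + (-4 * α * a * b) * w.re ^ 2 +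
      (2 * a * b - 2 * α * b ^ 2) * (w.re * ‖w‖ ^ 2) + b ^ 2 * ‖w‖ ^ 4) *
        Real.exp (-1 * ‖w‖ ^ 2)), gP.2, hα]
    rw [← mul_assoc, one_div, inv_mul_cancel₀ hpi.ne', one_mul]
    linear_combination (a ^ 2 * b ^ 2 - b ^ 2) * hab
  have e4 : ∀ z, ‖translatedPair a b α z‖ ^ 4 = 1 / Real.pi ^ 2 *
      ((a ^ 4 + (4 * a ^ 3 * b) * (z + α).re + (2 * a ^ 2 * b ^ 2) * ‖z + α‖ ^ 2 +
      (4 * a ^ 2 * b ^ 2) * (z + α).re ^ 2 + (4 * a * b ^ 3) * ((z + α).re * ‖z + α‖ ^ 2) +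
      b ^ 4 * ‖z + α‖ ^ 4) * Real.exp (-2 * ‖z + α‖ ^ 2)) := by
    intro z
    have h1 : Real.exp (-2 * ‖z + α‖ ^ 2) = Real.exp (-1 * ‖z + α‖ ^ 2) ^ 2 := by
      rw [← Real.exp_nat_mul]
      congr 1
      push_cast
      ring
    have h2 : ‖translatedPair a b α z‖ ^ 4 = (‖translatedPair a b α z‖ ^ 2) ^ 2 := by ring
    rw [h2, hn, h1]
    field_simp
    ring
  have g4 := gaussian_polynomial two_pos (a ^ 4) (4 * a ^ 3 * b) (2 * a ^ 2 * b ^ 2)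
    (4 * a ^ 2 * b ^ 2) (4 * a * b ^ 3) (b ^ 4)
  have i4 : Integrable fun z => ‖translatedPair a b α z‖ ^ 4 := by
    simp only [e4]
    exact (g4.1.comp_add_right (α : ℂ)).const_mul _
  have v4 : 2 * Real.pi * ∫ z, ‖translatedPair a b α z‖ ^ 4 = 1 - b ^ 4 / 2 := by
    simp only [e4]
    rw [integral_const_mul, integral_add_right_eq_self (fun w : ℂ => (a ^ 4 +
      (4 * a ^ 3 * b) * w.re + (2 * a ^ 2 * b ^ 2) * ‖w‖ ^ 2 +
      (4 * a ^ 2 * b ^ 2) * w.re ^ 2 + (4 * a * b ^ 3) * (w.re * ‖w‖ ^ 2) +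
      b ^ 4 * ‖w‖ ^ 4) * Real.exp (-2 * ‖w‖ ^ 2)), g4.2]
    field_simp
    linear_combination (4 * (a ^ 2 + b ^ 2 + 1)) * hab
  refine ⟨⟨⟨_, ?_, fun z => rfl⟩, ?_⟩, hM, fun μ => ?_⟩
  · fun_prop
  · exact (memLp_two_iff_integrable_sq_norm
      (continuous_translatedPair a b α).aestronglyMeasurable).2 i2
  · rw [energy_of_integrable μ i4 iP, v4, vP]
    congr 1
    ring

open Filter Topology

/-- A Gaussian bound uniform in the parameters, for dominated convergence; the exponent uses r -
r²/2 ≤ 1 - r²/4, that is, (r - 2)² ≥ 0. -/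
theorem norm_translatedPair_le {a b α : ℝ} (ha : |a| ≤ 1) (hb : |b| ≤ 1) (hα : |α| ≤ 1) (z : ℂ) :
    ‖translatedPair a b α z‖ ≤ (2 + ‖z‖) * Real.exp (1 - ‖z‖ ^ 2 / 4) := by
  have h1 : ‖Complex.exp (-α * z)‖ ≤ Real.exp ‖z‖ := by
    refine (Complex.norm_exp_le_exp_norm _).trans (Real.exp_le_exp.2 ?_)
    rw [norm_mul, norm_neg, Complex.norm_real]
    exact mul_le_of_le_one_left (norm_nonneg _) hα
  have h2 : ‖(a + b * (z + α) : ℂ)‖ ≤ 2 + ‖z‖ := by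
    refine (norm_add_le _ _).trans ?_
    rw [norm_mul, Complex.norm_real, Complex.norm_real]
    have h3 : ‖z + α‖ ≤ ‖z‖ + 1 := (norm_add_le _ _).trans (by
      rw [Complex.norm_real]
      exact add_le_add_right hα _)
    have h4 : ‖b‖ * ‖z + α‖ ≤ ‖z‖ + 1 := (mul_le_of_le_one_left (norm_nonneg _) hb).trans h3
    have h5 : ‖a‖ ≤ 1 := ha
    linarith
  have h3 : 1 / Real.sqrt Real.pi * Real.exp (-α ^ 2 / 2) ≤ 1 := by
    have hs : 1 ≤ Real.sqrt Real.pi := by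
      rw [Real.one_le_sqrt]
      linarith [Real.pi_gt_three]
    have he : Real.exp (-α ^ 2 / 2) ≤ 1 := by
      rw [Real.exp_le_one_iff]
      nlinarith [sq_nonneg α]
    exact mul_le_one₀ ((div_le_one (by linarith)).2 hs) (Real.exp_pos _).le he
  rw [translatedPair, norm_mul, norm_mul, norm_mul, Complex.norm_real, Complex.norm_real,
    Real.norm_of_nonneg (by positivity), Real.norm_of_nonneg (by positivity)]
  calc _ ≤ Real.exp (-‖z‖ ^ 2 / 2) * (1 * ((2 + ‖z‖) * Real.exp ‖z‖)) := by gcongr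
    _ = (2 + ‖z‖) * Real.exp (-‖z‖ ^ 2 / 2 + ‖z‖) := by
      rw [Real.exp_add]
      ring
    _ ≤ _ := by
      gcongr
      nlinarith [sq_nonneg (‖z‖ - 2)]

/-- The translated pairs of vanishing angular momentum tend to the Gaussian. -/
theorem tendsto_weightedNorm_translatedPair :
    Tendsto (fun b : ℝ => weightedNorm (fun z =>
      translatedPair (Real.sqrt (1 - b ^ 2)) b (Real.sqrt (1 - b ^ 2) * b) z - phi0 z) ^ 2)
      (𝓝[>] 0) (𝓝 0) := by
  set d : ℝ → ℂ → ℂ := fun b z => (Real.sqrt (1 + ‖z‖ ^ 2) : ℂ) *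
    (translatedPair (Real.sqrt (1 - b ^ 2)) b (Real.sqrt (1 - b ^ 2) * b) z - phi0 z) with hd
  have hphi : Continuous phi0 := translatedPair_phi0 ▸ continuous_translatedPair 1 0 0
  have hdc : ∀ b, Continuous (d b) := fun b => by
    have := continuous_translatedPair (Real.sqrt (1 - b ^ 2)) b (Real.sqrt (1 - b ^ 2) * b)
    simp only [hd]
    fun_prop
  have hw : ∀ b, weightedNorm (fun z =>
      translatedPair (Real.sqrt (1 - b ^ 2)) b (Real.sqrt (1 - b ^ 2) * b) z - phi0 z) ^ 2 =
      ∫⁻ z, ENNReal.ofReal (‖d b z‖ ^ 2) := by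
    intro b
    have h := eLpNorm_nnreal_pow_eq_lintegral (μ := volume) (f := d b) (p := 2) two_ne_zero
    simp only [NNReal.coe_ofNat, ENNReal.rpow_ofNat] at h
    rw [weightedNorm]
    refine Eq.trans h (lintegral_congr fun z => ?_)
    rw [← ofReal_norm, ENNReal.ofReal_pow (norm_nonneg _)]
  simp only [hw]
  have hzero : ∫⁻ z, ENNReal.ofReal (‖d 0 z‖ ^ 2) = 0 := by
    simp [hd, translatedPair_phi0]
  rw [← hzero]
  -- The polynomial comes from (1 + r²)(2 + r)² ≤ (1 + r²)(8 + 2r²) = 8 + 10r² + 2r⁴.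
  set B : ℂ → ℝ := fun z => 4 * Real.exp 2 * ((8 + 0 * z.re + 10 * ‖z‖ ^ 2 + 0 * z.re ^ 2 +
    0 * (z.re * ‖z‖ ^ 2) + 2 * ‖z‖ ^ 4) * Real.exp (-(1 / 2) * ‖z‖ ^ 2)) with hB
  have hBi : Integrable B :=
    (gaussian_polynomial (by norm_num : (0 : ℝ) < 1 / 2) 8 0 10 0 0 2).1.const_mul _
  refine tendsto_lintegral_filter_of_dominated_convergence (fun z => ENNReal.ofReal (B z))
    (Eventually.of_forall fun b => ?_) ?_ hBi.lintegral_lt_top.ne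
    (Eventually.of_forall fun z => ?_)
  · have := hdc b
    fun_prop
  · filter_upwards [Ioo_mem_nhdsGT (zero_lt_one' ℝ)] with b hb
    refine Eventually.of_forall fun z => ENNReal.ofReal_le_ofReal ?_
    have ha1 : |Real.sqrt (1 - b ^ 2)| ≤ 1 := by
      rw [abs_of_nonneg (Real.sqrt_nonneg _)]
      exact Real.sqrt_le_one.2 (by nlinarith [sq_nonneg b])
    have hb1 : |b| ≤ 1 := by
      rw [abs_of_pos hb.1]
      exact hb.2.le
    have hab : |Real.sqrt (1 - b ^ 2) * b| ≤ 1 := by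
      rw [abs_mul]
      exact mul_le_one₀ ha1 (abs_nonneg _) hb1
    have n1 := norm_translatedPair_le ha1 hb1 hab z
    have n2 := norm_translatedPair_le (a := 1) (b := 0) (α := 0) (by simp) (by simp) (by simp) z
    rw [translatedPair_phi0] at n2
    set u := translatedPair (Real.sqrt (1 - b ^ 2)) b (Real.sqrt (1 - b ^ 2) * b) z
    have n3 : ‖u - phi0 z‖ ≤ 2 * ((2 + ‖z‖) * Real.exp (1 - ‖z‖ ^ 2 / 4)) :=
      (norm_sub_le _ _).trans (by linarith)
    have hE : Real.exp (1 - ‖z‖ ^ 2 / 4) ^ 2 = Real.exp 2 * Real.exp (-(1 / 2) * ‖z‖ ^ 2) := by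
      rw [← Real.exp_nat_mul, ← Real.exp_add]
      congr 1
      push_cast
      ring
    calc ‖d b z‖ ^ 2 = (1 + ‖z‖ ^ 2) * ‖u - phi0 z‖ ^ 2 := by
          simp only [hd]
          rw [norm_mul, mul_pow, Complex.norm_real, Real.norm_of_nonneg (Real.sqrt_nonneg _),
            Real.sq_sqrt (by positivity)]
      _ ≤ (1 + ‖z‖ ^ 2) * (2 * ((2 + ‖z‖) * Real.exp (1 - ‖z‖ ^ 2 / 4))) ^ 2 := by gcongr
      _ = 4 * Real.exp 2 * ((1 + ‖z‖ ^ 2) * (2 + ‖z‖) ^ 2 *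
          Real.exp (-(1 / 2) * ‖z‖ ^ 2)) := by
          linear_combination (4 * (1 + ‖z‖ ^ 2) * (2 + ‖z‖) ^ 2) * hE
      _ ≤ B z := by
          simp only [hB]
          gcongr
          nlinarith [mul_nonneg (by positivity : 0 ≤ 1 + ‖z‖ ^ 2) (sq_nonneg (‖z‖ - 2))]
  · have hc : Continuous fun b => ENNReal.ofReal (‖d b z‖ ^ 2) := by
      refine ENNReal.continuous_ofReal.comp ?_
      simp only [hd, translatedPair]
      fun_prop
    exact (hc.tendsto 0).mono_left nhdsWithin_le_nhds

/-! ### Symmetries, and failure of strict minimality for μ ≤ 1/2. -/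

theorem phi0_ne_zero (z : ℂ) : phi0 z ≠ 0 := by
  rw [phi0, Complex.ofReal_ne_zero]
  have := Real.pi_pos
  positivity

theorem spaceRotation_phi0 (θ : ℝ) : spaceRotation θ phi0 = phi0 := by
  funext z
  have h : ‖Complex.exp (Complex.I * θ)‖ = 1 := by
    rw [mul_comm, Complex.norm_exp_ofReal_mul_I]
  simp only [spaceRotation, phi0, norm_mul, h, one_mul]

theorem phi0_data : phi0 ∈ bargmannFock ∧ mass phi0 = 1 ∧ ∀ μ : ℝ, energy μ phi0 = 1 := by
  have h := translatedPair_integrals (a := 1) (b := 0) (by norm_num)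
  simpa [translatedPair_phi0] using h

theorem phi1_data : phi1 ∈ bargmannFock ∧ mass phi1 = 1 ∧
    ∀ μ : ℝ, energy μ phi1 = ((μ + 1 / 2 : ℝ) : EReal) := by
  have h := translatedPair_integrals (a := 0) (b := 1) (by norm_num)
  simp only [zero_mul, translatedPair_phi1] at h
  refine ⟨h.1, h.2.1, fun μ => ?_⟩
  rw [h.2.2]
  congr 1
  ring

theorem norm_phaseRotation (γ : ℝ) (u : ℂ → ℂ) (z : ℂ) : ‖phaseRotation γ u z‖ = ‖u z‖ := by
  rw [phaseRotation, norm_mul, mul_comm, mul_comm Complex.I, Complex.norm_exp_ofReal_mul_I, mul_one]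

theorem energy_phaseRotation (μ γ : ℝ) (u : ℂ → ℂ) :
    energy μ (phaseRotation γ u) = energy μ u := by
  simp only [energy, hamiltonian, angularMomentum, norm_phaseRotation]

theorem mass_phaseRotation (γ : ℝ) (u : ℂ → ℂ) : mass (phaseRotation γ u) = mass u := by
  simp only [mass, norm_phaseRotation]

theorem phaseRotation_mem_bargmannFock (γ : ℝ) {u : ℂ → ℂ} (hu : u ∈ bargmannFock) :
    phaseRotation γ u ∈ bargmannFock := by
  obtain ⟨⟨f, hf, huf⟩, hL⟩ := hu
  refine ⟨⟨fun z => Complex.exp (Complex.I * γ) * f z, by fun_prop, fun z => ?_⟩,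
    hL.const_mul _⟩
  rw [phaseRotation, huf]
  ring

theorem not_isStrictLocalMinimizer_phi0 {μ : ℝ} (hμ : μ ≤ 1 / 2) :
    ¬ IsStrictLocalMinimizer μ phi0 := by
  rintro ⟨-, -, ε, hε, h⟩
  have hev := tendsto_weightedNorm_translatedPair.eventually_lt_const
    (show (0 : ℝ≥0∞) < ε ^ 2 from ENNReal.pow_pos hε 2)
  obtain ⟨b, hlt, hb0, hb1⟩ := (hev.and (Ioo_mem_nhdsGT (zero_lt_one' ℝ))).exists
  have hb2 : 0 ≤ 1 - b ^ 2 := by nlinarith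
  obtain ⟨hmem, hmass, hen⟩ := translatedPair_integrals (a := Real.sqrt (1 - b ^ 2)) (b := b)
    (by rw [Real.sq_sqrt hb2]; ring)
  have hlt' := h _ hmem hmass (lt_of_pow_lt_pow_left' 2 hlt) fun γ θ heq => by
    set a := Real.sqrt (1 - b ^ 2)
    -- The competitor has a zero at this point, whereas φ₀ has none, so it is not a rotation of φ₀.
    have hz := congrFun heq (-a / b - (a * b : ℝ))
    have hbc : (b : ℂ) ≠ 0 := by exact_mod_cast hb0.ne'
    have hv : (a + b * ((-a / b - (a * b : ℝ)) + (a * b : ℝ)) : ℂ) = 0 := by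
      rw [sub_add_cancel]
      field_simp
      ring
    rw [translatedPair, hv, zero_mul, mul_zero, mul_zero, spaceRotation_phi0, phaseRotation] at hz
    exact mul_ne_zero (Complex.exp_ne_zero _) (phi0_ne_zero _) hz.symm
  rw [phi0_data.2.2, hen, ← EReal.coe_one, EReal.coe_lt_coe_iff] at hlt'
  -- Strictness would give 1 < 1 + (μ - 1/2)b⁴, impossible for μ ≤ 1/2; at μ = 1/2 the competitors
  -- tie with φ₀.
  nlinarith [pow_pos hb0 4]

end LLL

theorem theorem1p1 (μ : ℝ) :
    (1 / 2 < μ →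
      ∀ u : ℂ → ℂ, LLL.IsGlobalMinimizer μ u ↔ ∃ γ : ℝ, u = LLL.phaseRotation γ LLL.phi0) ∧
    (∀ θ : ℝ, LLL.spaceRotation θ LLL.phi0 = LLL.phi0) ∧
    (μ < 1 / 2 →
      LLL.phi1 ∈ LLL.bargmannFock ∧ LLL.mass LLL.phi1 = 1 ∧
        LLL.energy μ LLL.phi1 < LLL.energy μ LLL.phi0) ∧
    (LLL.IsStrictLocalMinimizer μ LLL.phi0 ↔ 1 / 2 < μ) := by
  obtain ⟨h0, hm0, he0⟩ := LLL.phi0_data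
  obtain ⟨h1, hm1, he1⟩ := LLL.phi1_data
  refine ⟨fun hμ u => ⟨fun ⟨hu, hm, hmin⟩ => ?_, ?_⟩, LLL.spaceRotation_phi0,
    fun hμ => ⟨h1, hm1, ?_⟩, fun h => ?_, fun hμ => ⟨h0, hm0, 1, one_pos, ?_⟩⟩
  · obtain ⟨hle, heq⟩ := LLL.one_le_energy hμ hu hm
    exact heq (le_antisymm (he0 μ ▸ hmin _ h0 hm0) hle)
  · rintro ⟨γ, rfl⟩
    refine ⟨LLL.phaseRotation_mem_bargmannFock γ h0, by rw [LLL.mass_phaseRotation, hm0],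
      fun u hu hm => ?_⟩
    rw [LLL.energy_phaseRotation, he0]
    exact (LLL.one_le_energy hμ hu hm).1
  · rw [he0, he1, ← EReal.coe_one, EReal.coe_lt_coe_iff]
    linarith
  · by_contra hμ
    exact LLL.not_isStrictLocalMinimizer_phi0 (not_lt.1 hμ) h
  -- The radius 1 is arbitrary: the energy bound and its equality case hold without any closeness
  -- assumption.
  · intro u hu hm _ hne
    obtain ⟨hle, heq⟩ := LLL.one_le_energy hμ hu hm
    rw [he0]
    refine lt_of_le_of_ne hle fun h => ?_
    obtain ⟨γ, hγ⟩ := heq h.symm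
    exact hne γ 0 (by rw [LLL.spaceRotation_phi0, hγ])
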